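/- Conventions: $e^{-\infty}=0$, $\log(1/0)=\infty$. A $d$-variate copula is a function on $[0,1]^d$ that is grounded, has uniform margins and assigns nonnegative volume to every box. A copula $C$ is an *extended one-factor copula* (EOFC) with inner copulas $C^\diamond_{u_0}$ ($d$-variate, $0<u_0<1$) and linking copulas $C_1,\dots,C_d$ (bivariate) if, for all $u\in[0,1]^d$, $$C(u_1,\dots,u_d)=\int_0^1 C^\diamond_{u_0}\Big(\frac{\partial C_1(u_1,u_0)}{\partial u_0},\dots,\frac{\partial C_d(u_d,u_0)}{\partial u_0}\Big)\,du_0 .\qquad(*)$$ Let $f_0\ge 0$ be the density of a probability distribution with support $[0,\infty)$, with distribution function $F_0$ and quantile function $Q_0=F_0^{-1}$ (so $Q_0(1)=\infty$), and let $F_{12}$ be the distribution function of a probability distribution on $(0,\infty)$. For $x\in[0,\infty]$ put $$\psi_{123}(x)=\int_0^\infty e^{-tx}f_0(t)\,dt,\qquad \psi_{12}(x)=\int_0^\infty e^{-tx}\,dF_{12}(t);$$ both are decreasing bijections $[0,\infty]\to[0,1]$. Let $\nu=\psi_{123}^{-1}\circ\psi_{12}$, $\nu^{-1}=\psi_{12}^{-1}\circ\psi_{123}$,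 and define, for $u_i,u_0,u,v,w\in[0,1]$ and $x_0>0$, $$C_i(u_i,u_0)=\int_0^{Q_0(u_0)}e^{-t\psi_{123}^{-1}(u_i)}f_0(t)\,dt\quad(i=1,2,3),$$ $$C_{x_0}(u,v,w)=\exp\Big(-x_0\,\nu\Big(\nu^{-1}\big[\tfrac1{x_0}\log\tfrac1u\big]+\nu^{-1}\big[\tfrac1{x_0}\log\tfrac1v\big]\Big)\Big)\,w,$$ $$N(u_1,u_2,u_3)=\psi_{123}\Big(\psi_{123}^{-1}\big(\psi_{12}(\psi_{12}^{-1}(u_1)+\psi_{12}^{-1}(u_2))\big)+\psi_{123}^{-1}(u_3)\Big).$$ Then: 1. Each $C_i$ is a copula. 2. With $d=3$ and $C^\diamond_{u_0}=C_{Q_0(u_0)}$, the integral on the right of $(*)$ converges and equals $N(u_1,u_2,u_3)$ for all $(u_1,u_2,u_3)\in[0,1]^3$. 3. If $N$ is a copula (the nested Archimedean copula with generators $\psi_{123},\psi_{12}$), then $C_{x_0}$ is a copula for every $x_0>0$, and $N$ is the EOFC with inner copulas $C_{Q_0(u_0)}$ and linking copulas $C_1,C_2,C_3$. 4. If $\nu$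 is concave on $(0,\infty)$ (in particular, if $\nu'$ is completely monotone), then $N$ is a copula. -/

import Mathlib

open MeasureTheory Set
open scoped ENNReal

noncomputable section

/-- A `d`-variate copula: a function on `[0,1]^d` which is grounded, has uniform margins, and gives
nonnegative volume to every box `[a, b]` (only the values on `[0,1]^d` matter). -/
structure IsCopula {d : ℕ} (C : (Fin d → ℝ) → ℝ) : Prop where
  grounded : ∀ u : Fin d → ℝ, (∀ i, u i ∈ Icc (0 : ℝ) 1) → (∃ i, u i = 0) → C u = 0
  margin : ∀ (i : Fin d) (x : ℝ), x ∈ Icc (0 : ℝ) 1 →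
    C (Function.update (fun _ => (1 : ℝ)) i x) = x
  increasing : ∀ a b : Fin d → ℝ, (∀ i, a i ∈ Icc (0 : ℝ) 1) → (∀ i, b i ∈ Icc (0 : ℝ) 1) →
    (∀ i, a i ≤ b i) →
    0 ≤ ∑ s : Finset (Fin d), (-1 : ℝ) ^ s.card * C (fun i => if i ∈ s then a i else b i)

/-- A bivariate function is a copula. -/
def IsBivariateCopula (L : ℝ → ℝ → ℝ) : Prop :=
  IsCopula (fun w : Fin 2 → ℝ => L (w 0) (w 1))

/-- The integrand `C_{u₀}(∂C₁(u₁,u₀)/∂u₀, …, ∂C_d(u_d,u₀)/∂u₀)`, with inner copulas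
`inner u₀ = C_{u₀}` and linking copulas `link i = C_i`. -/
def eofcIntegrand {d : ℕ} (inner : ℝ → (Fin d → ℝ) → ℝ) (link : Fin d → ℝ → ℝ → ℝ)
    (u : Fin d → ℝ) (u₀ : ℝ) : ℝ :=
  inner u₀ (fun i => deriv (fun t => link i (u i) t) u₀)

/-- `C` is represented on `[0,1]^d` as
`C(u) = ∫₀¹ C_{u₀}(∂C₁(u₁,u₀)/∂u₀, …, ∂C_d(u_d,u₀)/∂u₀) du₀`, the integral being convergent. -/
def HasEOFCRepresentation {d : ℕ} (inner : ℝ → (Fin d → ℝ) → ℝ) (link : Fin d → ℝ → ℝ → ℝ)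
    (C : (Fin d → ℝ) → ℝ) : Prop :=
  ∀ u : Fin d → ℝ, (∀ i, u i ∈ Icc (0 : ℝ) 1) →
    IntervalIntegrable (eofcIntegrand inner link u) volume 0 1 ∧
      C u = ∫ u₀ in (0 : ℝ)..1, eofcIntegrand inner link u u₀

/-- `C` is the extended one-factor copula with inner copulas `inner u₀`, `0 < u₀ < 1`, and
linking copulas `link i`. -/
structure IsEOFCOf {d : ℕ} (inner : ℝ → (Fin d → ℝ) → ℝ) (link : Fin d → ℝ → ℝ → ℝ)
    (C : (Fin d → ℝ) → ℝ) : Prop where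
  inner_copula : ∀ u₀ ∈ Ioo (0 : ℝ) 1, IsCopula (inner u₀)
  link_copula : ∀ i, IsBivariateCopula (link i)
  copula : IsCopula C
  representation : HasEOFCRepresentation inner link C

/-- `e^{-x}` for `x ∈ [0,∞]`, with `e^{-∞} = 0`. -/
def expNeg (x : ℝ≥0∞) : ℝ := if x = ∞ then 0 else Real.exp (-x.toReal)

/-- `log (1/u) ∈ [0,∞]` for `u ∈ [0,1]`, with `log (1/0) = ∞`. -/
def logInv (u : ℝ) : ℝ≥0∞ := if u ≤ 0 then ∞ else ENNReal.ofReal (Real.log (1 / u))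

/-- The law `f₀(t) dt` of the factor with density `f₀`. -/
def factorLaw (f₀ : ℝ → ℝ) : Measure ℝ := volume.withDensity (fun t => ENNReal.ofReal (f₀ t))

/-- The Laplace transform `ψ(x) = ∫_{[0,∞)} e^{-t x} dμ(t)`, for `x ∈ [0,∞]`. -/
def laplace (μ : Measure ℝ) (x : ℝ≥0∞) : ℝ := ∫ t in Ici (0 : ℝ), expNeg (ENNReal.ofReal t * x) ∂μ

/-- The inverse `ψ⁻¹ : [0,1] → [0,∞]` of the Laplace transform of a law on `(0,∞)`, which is a
decreasing bijection from `[0,∞]` onto `[0,1]`. -/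
def laplaceInv (μ : Measure ℝ) : ℝ → ℝ≥0∞ := Function.invFun (laplace μ)

/-- The distribution function of a law on `[0,∞)`, on `[0,∞]`. -/
def distFun (μ : Measure ℝ) (x : ℝ≥0∞) : ℝ := μ.real {t : ℝ | ENNReal.ofReal t ≤ x}

/-- The inverse (quantile function) `[0,1] → [0,∞]` of the distribution function. -/
def quantile (μ : Measure ℝ) (u : ℝ) : ℝ≥0∞ := sInf {x : ℝ≥0∞ | u ≤ distFun μ x}

/-- `C_i(u,u₀) = ∫₀^{Q₀(u₀)} e^{-t ψ⁻¹(u)} dμ(t)`, where `Q₀` is the quantile function and `ψ` the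
Laplace transform of `μ`. -/
def archimedeanLink (μ : Measure ℝ) (u u₀ : ℝ) : ℝ :=
  ∫ t in {t : ℝ | 0 ≤ t ∧ ENNReal.ofReal t ≤ quantile μ u₀},
    expNeg (ENNReal.ofReal t * laplaceInv μ u) ∂μ

/-- `ν = ψ₁₂₃⁻¹ ∘ ψ₁₂`. -/
def nu (μ₁₂₃ μ₁₂ : Measure ℝ) (s : ℝ≥0∞) : ℝ≥0∞ := laplaceInv μ₁₂₃ (laplace μ₁₂ s)

/-- `ν⁻¹ = ψ₁₂⁻¹ ∘ ψ₁₂₃`. -/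
def nuInv (μ₁₂₃ μ₁₂ : Measure ℝ) (s : ℝ≥0∞) : ℝ≥0∞ := laplaceInv μ₁₂ (laplace μ₁₂₃ s)

/-- `C_{x₀}(u,v,w) = exp(-x₀ ν(ν⁻¹[log(1/u)/x₀] + ν⁻¹[log(1/v)/x₀])) w`, for `x₀ > 0`. -/
def nestedInner (μ₁₂₃ μ₁₂ : Measure ℝ) (x₀ : ℝ) (u : Fin 3 → ℝ) : ℝ :=
  expNeg (ENNReal.ofReal x₀ * nu μ₁₂₃ μ₁₂
    (nuInv μ₁₂₃ μ₁₂ (ENNReal.ofReal (1 / x₀) * logInv (u 0)) +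
      nuInv μ₁₂₃ μ₁₂ (ENNReal.ofReal (1 / x₀) * logInv (u 1)))) * u 2

/-- `ψ₁₂₃(ψ₁₂₃⁻¹(ψ₁₂(ψ₁₂⁻¹(u₁) + ψ₁₂⁻¹(u₂))) + ψ₁₂₃⁻¹(u₃))`. -/
def nestedArchimedean (μ₁₂₃ μ₁₂ : Measure ℝ) (u : Fin 3 → ℝ) : ℝ :=
  laplace μ₁₂₃ (laplaceInv μ₁₂₃ (laplace μ₁₂ (laplaceInv μ₁₂ (u 0) + laplaceInv μ₁₂ (u 1))) +
    laplaceInv μ₁₂₃ (u 2))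

end

/-! Write `μ` for the law with density `f₀`. It has no atoms and charges every interval in `[0,∞)`,
so `F₀` and `Q₀` are mutually inverse, and `Q₀` pushes the uniform law on `(0,1)` forward to `μ`
(`map_quantile`). Hence `C_i(u,v) = ∫₀^v exp(-Q₀(w) ψ₁₂₃⁻¹(u)) dw`, whose `v`-derivative is
`exp(-Q₀(v) ψ₁₂₃⁻¹(u))`. Inserted into the inner copula at `x₀ = Q₀(v)`, this makes the logarithms
cancel `x₀` and `ν⁻¹` turn `ψ₁₂₃⁻¹(u_i)` into `ψ₁₂⁻¹(u_i)`. The integrand becomes `exp(-Q₀(v) X)`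
with `N = ψ₁₂₃(X)`, which gives the representation.

The copula statements all pass through one condition, `SubmodularSum`: the second differences of
`(a,b) ↦ ν(a+b)` are nonpositive. It gives `exp(-xν(a+b))` nonnegative second differences, so each
`C_{x₀}` is a copula, and so is `N` after mixing over `x`. Concavity of `ν` implies it.

Conversely, if `N` is a copula, suitable box volumes are integrals against `μ` of a second
difference of `exp(-tν)` times `exp(-tc)`, with `c ≥ 0` arbitrary. As `c → ∞` the weight
concentrates at `t = 0`, where the second difference of `exp(-tν)` is to first order `-t` times that
of `ν`; the sign of the latter follows (`submodularSum_nu_of_isCopula`). -/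

/-! ### The exponential and logarithm on `[0,∞]` -/

theorem expNeg_zero : expNeg 0 = 1 := by simp [expNeg]

theorem expNeg_top : expNeg ∞ = 0 := by simp [expNeg]

theorem expNeg_of_ne_top {x : ℝ≥0∞} (hx : x ≠ ∞) : expNeg x = Real.exp (-x.toReal) := by
  simp [expNeg, hx]

theorem expNeg_ofReal {x : ℝ} (hx : 0 ≤ x) : expNeg (ENNReal.ofReal x) = Real.exp (-x) := by
  rw [expNeg_of_ne_top ENNReal.ofReal_ne_top, ENNReal.toReal_ofReal hx]

theorem expNeg_nonneg (x : ℝ≥0∞) : 0 ≤ expNeg x := by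
  unfold expNeg; split_ifs <;> positivity

theorem expNeg_add (x y : ℝ≥0∞) : expNeg (x + y) = expNeg x * expNeg y := by
  by_cases hx : x = ∞
  · simp [hx, expNeg_top]
  by_cases hy : y = ∞
  · simp [hy, expNeg_top]
  rw [expNeg_of_ne_top hx, expNeg_of_ne_top hy, expNeg_of_ne_top (by simp [hx, hy]),
    ENNReal.toReal_add hx hy, ← Real.exp_add]
  congr 1; ring

theorem expNeg_strictAnti : StrictAnti expNeg := by
  intro x y hxy
  have hx : x ≠ ∞ := hxy.ne_top
  rw [expNeg_of_ne_top hx]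
  by_cases hy : y = ∞
  · rw [hy, expNeg_top]; positivity
  · rw [expNeg_of_ne_top hy]
    exact Real.exp_lt_exp.2 (neg_lt_neg ((ENNReal.toReal_lt_toReal hx hy).2 hxy))

theorem expNeg_le_one (x : ℝ≥0∞) : expNeg x ≤ 1 := by
  rw [← expNeg_zero]; exact expNeg_strictAnti.antitone bot_le

theorem norm_expNeg_le_one (x : ℝ≥0∞) : ‖expNeg x‖ ≤ 1 := by
  rw [Real.norm_of_nonneg (expNeg_nonneg x)]; exact expNeg_le_one x

theorem expNeg_logInv {u : ℝ} (hu : u ∈ Icc (0 : ℝ) 1) : expNeg (logInv u) = u := by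
  unfold logInv
  split_ifs with h
  · rw [expNeg_top, le_antisymm h hu.1]
  · push Not at h
    rw [expNeg_ofReal (Real.log_nonneg (by rw [le_div_iff₀ h]; simpa using hu.2)), one_div,
      Real.log_inv, neg_neg, Real.exp_log h]

theorem logInv_expNeg (x : ℝ≥0∞) : logInv (expNeg x) = x :=
  expNeg_strictAnti.injective (expNeg_logInv ⟨expNeg_nonneg x, expNeg_le_one x⟩)

theorem continuous_expNeg : Continuous expNeg := by
  -- A monotone surjection between linear orders is continuous; the order dual turns the decreasing
  -- map into an increasing one.
  let f : ℝ≥0∞ → (Icc (0 : ℝ) 1)ᵒᵈ := fun x =>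
    OrderDual.toDual ⟨expNeg x, expNeg_nonneg x, expNeg_le_one x⟩
  have hmono : Monotone f := fun x y hxy => expNeg_strictAnti.antitone hxy
  have hsurj : Function.Surjective f := fun u =>
    ⟨logInv (OrderDual.ofDual u : Icc (0 : ℝ) 1),
      Subtype.ext (expNeg_logInv (OrderDual.ofDual u).2)⟩
  exact continuous_subtype_val.comp (continuous_ofDual.comp (hmono.continuous_of_surjective hsurj))

/-! ### Laplace transforms as decreasing bijections -/

theorem measurable_expNeg_mul (x : ℝ≥0∞) :
    Measurable fun t : ℝ => expNeg (ENNReal.ofReal t * x) :=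
  continuous_expNeg.measurable.comp (ENNReal.measurable_ofReal.mul_const x)

theorem integrable_expNeg_mul (m : Measure ℝ) [IsFiniteMeasure m] (x : ℝ≥0∞) :
    Integrable (fun t : ℝ => expNeg (ENNReal.ofReal t * x)) m :=
  Integrable.of_bound (measurable_expNeg_mul x).aestronglyMeasurable 1
    (ae_of_all _ fun _ => norm_expNeg_le_one _)

theorem ae_pos_of_measure_Iic {m : Measure ℝ} (hm : m (Iic 0) = 0) : ∀ᵐ t ∂m, 0 < t := by
  rw [ae_iff]; simpa [Iic] using hm

theorem laplace_eq_integral {m : Measure ℝ} (hm : m (Iic 0) = 0) (x : ℝ≥0∞) :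
    laplace m x = ∫ t, expNeg (ENNReal.ofReal t * x) ∂m := by
  unfold laplace
  rw [Measure.restrict_eq_self_of_ae_mem]
  filter_upwards [ae_pos_of_measure_Iic hm] with t ht using ht.le

theorem laplace_top {m : Measure ℝ} (hm : m (Iic 0) = 0) : laplace m ∞ = 0 := by
  rw [laplace_eq_integral hm]
  refine integral_eq_zero_of_ae ?_
  filter_upwards [ae_pos_of_measure_Iic hm] with t ht
  simp [ENNReal.mul_top, ht, expNeg_top]

section Laplace

variable {m : Measure ℝ} [IsProbabilityMeasure m]

theorem laplace_zero (hm : m (Iic 0) = 0) : laplace m 0 = 1 := by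
  simp [laplace_eq_integral hm, expNeg_zero]

theorem laplace_strictAnti (hm : m (Iic 0) = 0) : StrictAnti (laplace m) := by
  intro x y hxy
  rw [laplace_eq_integral hm, laplace_eq_integral hm, ← sub_pos,
    ← integral_sub (integrable_expNeg_mul m x) (integrable_expNeg_mul m y)]
  have hlt : ∀ t : ℝ, 0 < t →
      0 < expNeg (ENNReal.ofReal t * x) - expNeg (ENNReal.ofReal t * y) := fun t ht =>
    sub_pos.2 (expNeg_strictAnti
      (ENNReal.mul_lt_mul_right (by simpa using ht) ENNReal.ofReal_ne_top hxy))
  rw [integral_pos_iff_support_of_nonneg_ae]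
  · refine lt_of_lt_of_le ?_ (measure_mono (s := Ioi 0) fun t ht => (hlt t ht).ne')
    rw [← compl_Iic, (prob_compl_eq_one_iff measurableSet_Iic).2 hm]
    exact one_pos
  · filter_upwards [ae_pos_of_measure_Iic hm] with t ht using (hlt t ht).le
  · exact (integrable_expNeg_mul m x).sub (integrable_expNeg_mul m y)

theorem continuous_laplace (hm : m (Iic 0) = 0) : Continuous (laplace m) := by
  simp_rw [funext (laplace_eq_integral hm)]
  refine continuous_of_dominated (bound := fun _ => 1)
    (fun x => (measurable_expNeg_mul x).aestronglyMeasurable)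
    (fun x => ae_of_all _ fun _ => norm_expNeg_le_one _) (integrable_const 1) ?_
  exact ae_of_all _ fun t => continuous_expNeg.comp
    (ENNReal.continuous_const_mul ENNReal.ofReal_ne_top)

theorem laplace_mem_Icc (hm : m (Iic 0) = 0) (x : ℝ≥0∞) : laplace m x ∈ Icc (0 : ℝ) 1 := by
  have h := (laplace_strictAnti hm).antitone
  exact ⟨laplace_top hm ▸ h le_top, laplace_zero hm ▸ h bot_le⟩

theorem laplaceInv_laplace (hm : m (Iic 0) = 0) (x : ℝ≥0∞) : laplaceInv m (laplace m x) = x :=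
  Function.leftInverse_invFun (laplace_strictAnti hm).injective x

theorem laplace_laplaceInv (hm : m (Iic 0) = 0) {u : ℝ} (hu : u ∈ Icc (0 : ℝ) 1) :
    laplace m (laplaceInv m u) = u :=
  Function.invFun_eq (mem_range_of_exists_le_of_exists_ge (continuous_laplace hm)
    ⟨∞, (laplace_top hm).trans_le hu.1⟩ ⟨0, hu.2.trans_eq (laplace_zero hm).symm⟩)

theorem laplaceInv_zero (hm : m (Iic 0) = 0) : laplaceInv m 0 = ∞ := by
  rw [← laplace_top hm, laplaceInv_laplace hm]

theorem laplaceInv_one (hm : m (Iic 0) = 0) : laplaceInv m 1 = 0 := by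
  rw [← laplace_zero hm, laplaceInv_laplace hm]

theorem laplaceInv_le_laplaceInv (hm : m (Iic 0) = 0) {u v : ℝ} (hu : u ∈ Icc (0 : ℝ) 1)
    (hv : v ∈ Icc (0 : ℝ) 1) (huv : u ≤ v) : laplaceInv m v ≤ laplaceInv m u := by
  rwa [← (laplace_strictAnti hm).le_iff_ge, laplace_laplaceInv hm hu, laplace_laplaceInv hm hv]

end Laplace

/-! ### The transition functions `ν` and `ν⁻¹` -/

theorem nuInv_laplaceInv {m₁ m₂ : Measure ℝ} [IsProbabilityMeasure m₁]
    (h₁ : m₁ (Iic 0) = 0) {u : ℝ} (hu : u ∈ Icc (0 : ℝ) 1) :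
    nuInv m₁ m₂ (laplaceInv m₁ u) = laplaceInv m₂ u := by
  rw [nuInv, laplace_laplaceInv h₁ hu]

theorem nu_top {m₁ m₂ : Measure ℝ} [IsProbabilityMeasure m₁]
    (h₁ : m₁ (Iic 0) = 0) (h₂ : m₂ (Iic 0) = 0) : nu m₁ m₂ ∞ = ∞ := by
  rw [nu, laplace_top h₂, laplaceInv_zero h₁]

theorem nuInv_top {m₁ m₂ : Measure ℝ} [IsProbabilityMeasure m₂]
    (h₁ : m₁ (Iic 0) = 0) (h₂ : m₂ (Iic 0) = 0) : nuInv m₁ m₂ ∞ = ∞ := by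
  rw [nuInv, laplace_top h₁, laplaceInv_zero h₂]

section Nu

variable {m₁ m₂ : Measure ℝ} [IsProbabilityMeasure m₁] [IsProbabilityMeasure m₂]

theorem nu_nuInv (h₁ : m₁ (Iic 0) = 0) (h₂ : m₂ (Iic 0) = 0) (s : ℝ≥0∞) :
    nu m₁ m₂ (nuInv m₁ m₂ s) = s := by
  rw [nu, nuInv, laplace_laplaceInv h₂ (laplace_mem_Icc h₁ s), laplaceInv_laplace h₁]

theorem nu_strictMono (h₁ : m₁ (Iic 0) = 0) (h₂ : m₂ (Iic 0) = 0) : StrictMono (nu m₁ m₂) := by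
  intro x y hxy
  rw [← (laplace_strictAnti h₁).lt_iff_gt, nu, nu, laplace_laplaceInv h₁ (laplace_mem_Icc h₂ x),
    laplace_laplaceInv h₁ (laplace_mem_Icc h₂ y)]
  exact laplace_strictAnti h₂ hxy

theorem nu_zero (h₁ : m₁ (Iic 0) = 0) (h₂ : m₂ (Iic 0) = 0) : nu m₁ m₂ 0 = 0 := by
  rw [nu, laplace_zero h₂, laplaceInv_one h₁]

theorem nu_ne_top (h₁ : m₁ (Iic 0) = 0) (h₂ : m₂ (Iic 0) = 0) {s : ℝ≥0∞} (hs : s ≠ ∞) :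
    nu m₁ m₂ s ≠ ∞ := by
  rw [← nu_top h₁ h₂]; exact (nu_strictMono h₁ h₂).injective.ne hs

theorem nuInv_zero (h₁ : m₁ (Iic 0) = 0) (h₂ : m₂ (Iic 0) = 0) : nuInv m₁ m₂ 0 = 0 := by
  rw [nuInv, laplace_zero h₁, laplaceInv_one h₂]

theorem nuInv_monotone (h₁ : m₁ (Iic 0) = 0) (h₂ : m₂ (Iic 0) = 0) :
    Monotone (nuInv m₁ m₂) := by
  intro x y hxy
  rw [← (nu_strictMono h₁ h₂).le_iff_le, nu_nuInv h₁ h₂, nu_nuInv h₁ h₂]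
  exact hxy

end Nu

/-! ### The factor law: no atoms, full support -/

section FactorLaw

variable {f₀ : ℝ → ℝ}

theorem factorLaw_absolutelyContinuous : factorLaw f₀ ≪ volume :=
  withDensity_absolutelyContinuous _ _

theorem factorLaw_singleton (t : ℝ) : factorLaw f₀ {t} = 0 :=
  factorLaw_absolutelyContinuous (by simp)

theorem factorLaw_Iic_zero (hsupp : (factorLaw f₀).support = Ici 0) :
    factorLaw f₀ (Iic 0) = 0 := by
  have h : factorLaw f₀ (Iio 0) = 0 := by
    rw [← compl_Ici, ← hsupp]; exact Measure.measure_compl_support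
  rw [← Iio_union_right]
  exact measure_union_null h (factorLaw_singleton 0)

/-- The midpoint lies in the support. This positivity makes `F₀` strictly increasing, and near the
origin it drives the tilting argument. -/
theorem factorLaw_Ioo_pos (hsupp : (factorLaw f₀).support = Ici 0) {a b : ℝ} (ha : 0 ≤ a)
    (hab : a < b) : 0 < factorLaw f₀ (Ioo a b) := by
  have hmem : (a + b) / 2 ∈ (factorLaw f₀).support := by
    rw [hsupp]; show 0 ≤ (a + b) / 2; linarith
  exact (Measure.mem_support_iff_forall _).1 hmem _ (Ioo_mem_nhds (by linarith) (by linarith))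

end FactorLaw

/-! ### Distribution function, quantile function, inverse transform -/

section Quantile

theorem distFun_ofReal {m : Measure ℝ} {x : ℝ} (hx : 0 ≤ x) :
    distFun m (ENNReal.ofReal x) = m.real (Iic x) := by
  unfold distFun
  congr 1
  ext t
  simp [ENNReal.ofReal_le_ofReal_iff hx]

theorem measure_ofReal_eq {m : Measure ℝ} (hm : m (Iic 0) = 0) (ha : ∀ t, m {t} = 0) (x : ℝ≥0∞) :
    m {t : ℝ | ENNReal.ofReal t = x} = 0 := by
  by_cases hx : x = 0
  · simpa [hx, ← Iic_def] using hm
  · refine measure_mono_null (fun t (ht : ENNReal.ofReal t = x) => ?_) (ha x.toReal)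
    have h0 : 0 < t := by
      by_contra h
      exact hx (by rw [← ht, ENNReal.ofReal_eq_zero]; linarith)
    simp [← ht, ENNReal.toReal_ofReal h0.le]

theorem quantile_mono {m : Measure ℝ} : Monotone (quantile m) := fun _ _ h =>
  sInf_le_sInf fun _ hx => le_trans h hx

theorem distFun_zero {m : Measure ℝ} (hm : m (Iic 0) = 0) : distFun m 0 = 0 := by
  rw [← ENNReal.ofReal_zero, distFun_ofReal le_rfl, measureReal_def, hm, ENNReal.toReal_zero]

variable {m : Measure ℝ} [IsProbabilityMeasure m]

theorem measurableSet_ofReal_le (x : ℝ≥0∞) : MeasurableSet {t : ℝ | ENNReal.ofReal t ≤ x} :=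
  ENNReal.measurable_ofReal measurableSet_Iic

theorem distFun_top : distFun m ∞ = 1 := by simp [distFun]

theorem distFun_mem_Icc (x : ℝ≥0∞) : distFun m x ∈ Icc (0 : ℝ) 1 :=
  ⟨measureReal_nonneg, measureReal_le_one⟩

/-- Dominated convergence: as `x` varies, the indicator of `ENNReal.ofReal t ≤ x` can jump only
where equality holds, a null set of `t`. -/
theorem continuous_distFun (hm : m (Iic 0) = 0) (ha : ∀ t, m {t} = 0) :
    Continuous (distFun m) := by
  have h : distFun m =
      fun x => ∫ t, ({t : ℝ | ENNReal.ofReal t ≤ x}.indicator (fun _ => (1 : ℝ)) t) ∂m := by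
    funext x
    rw [integral_indicator (measurableSet_ofReal_le x)]
    simp [distFun]
  rw [h, continuous_iff_continuousAt]
  intro x
  refine continuousAt_of_dominated (bound := fun _ => 1)
    (Filter.Eventually.of_forall fun y =>
      (measurable_const.indicator (measurableSet_ofReal_le y)).aestronglyMeasurable)
    (Filter.Eventually.of_forall fun y => ae_of_all _ fun t => ?_) (integrable_const 1) ?_
  · by_cases ht : ENNReal.ofReal t ≤ y <;> simp [indicator, ht]
  · have hne : ∀ᵐ t ∂m, ENNReal.ofReal t ≠ x := by
      rw [ae_iff]; simpa using measure_ofReal_eq hm ha x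
    filter_upwards [hne] with t ht
    rcases lt_or_gt_of_ne ht with hlt | hgt
    · refine (continuousAt_const (y := (1 : ℝ))).congr ?_
      filter_upwards [lt_mem_nhds hlt] with y hy
      simp [indicator, hy.le]
    · refine (continuousAt_const (y := (0 : ℝ))).congr ?_
      filter_upwards [gt_mem_nhds hgt] with y hy
      simp [indicator, hy]

theorem distFun_strictMono (hpos : ∀ a b : ℝ, 0 ≤ a → a < b → 0 < m (Ioo a b)) :
    StrictMono (distFun m) := by
  intro x y hxy
  obtain ⟨z, hxz, hzy⟩ := exists_between hxy
  have hx : x ≠ ∞ := hxy.ne_top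
  have hz : z ≠ ∞ := hzy.ne_top
  have h := hpos x.toReal z.toReal ENNReal.toReal_nonneg ((ENNReal.toReal_lt_toReal hx hz).2 hxz)
  have hdisj : Disjoint {t : ℝ | ENNReal.ofReal t ≤ x} (Ioo x.toReal z.toReal) := by
    rw [Set.disjoint_left]
    intro t (ht : ENNReal.ofReal t ≤ x) ht'
    exact absurd ht'.1 (not_lt.2 (ENNReal.ofReal_le_iff_le_toReal hx |>.1 ht))
  have hsub : {t : ℝ | ENNReal.ofReal t ≤ x} ∪ Ioo x.toReal z.toReal ⊆
      {t : ℝ | ENNReal.ofReal t ≤ y} := by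
    rintro t (ht | ht)
    · exact le_trans ht hxy.le
    · exact ((ENNReal.ofReal_le_iff_le_toReal hz).2 ht.2.le).trans hzy.le
  have h1 : distFun m x + m.real (Ioo x.toReal z.toReal) ≤ distFun m y := by
    rw [distFun, ← measureReal_union hdisj measurableSet_Ioo]
    exact measureReal_mono hsub
  have h2 : 0 < m.real (Ioo x.toReal z.toReal) := ENNReal.toReal_pos h.ne' (measure_ne_top _ _)
  linarith

theorem quantile_distFun (hpos : ∀ a b : ℝ, 0 ≤ a → a < b → 0 < m (Ioo a b)) (x : ℝ≥0∞) :
    quantile m (distFun m x) = x :=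
  le_antisymm (sInf_le (mem_ofPred.2 le_rfl))
    (le_sInf fun _ hy => (distFun_strictMono hpos).le_iff_le.1 hy)

theorem distFun_quantile (hm : m (Iic 0) = 0) (ha : ∀ t, m {t} = 0)
    (hpos : ∀ a b : ℝ, 0 ≤ a → a < b → 0 < m (Ioo a b)) {v : ℝ} (hv : v ∈ Icc (0 : ℝ) 1) :
    distFun m (quantile m v) = v := by
  obtain ⟨x, rfl⟩ := mem_range_of_exists_le_of_exists_ge (continuous_distFun hm ha)
    ⟨0, (distFun_zero hm).trans_le hv.1⟩ ⟨∞, hv.2.trans_eq distFun_top.symm⟩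
  rw [quantile_distFun hpos]

theorem continuous_quantile (hpos : ∀ a b : ℝ, 0 ≤ a → a < b → 0 < m (Ioo a b)) :
    Continuous (quantile m) :=
  quantile_mono.continuous_of_surjective fun x => ⟨_, quantile_distFun hpos x⟩

theorem quantile_one (hpos : ∀ a b : ℝ, 0 ≤ a → a < b → 0 < m (Ioo a b)) :
    quantile m 1 = ∞ := by
  rw [← distFun_top (m := m), quantile_distFun hpos]

theorem quantile_pos (hm : m (Iic 0) = 0) (ha : ∀ t, m {t} = 0)
    (hpos : ∀ a b : ℝ, 0 ≤ a → a < b → 0 < m (Ioo a b)) {v : ℝ} (hv : v ∈ Ioo (0 : ℝ) 1) :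
    quantile m v ≠ 0 := by
  intro h
  have := distFun_quantile hm ha hpos ⟨hv.1.le, hv.2.le⟩
  rw [h, distFun_zero hm] at this
  exact hv.1.ne this

theorem quantile_ne_top (hm : m (Iic 0) = 0) (ha : ∀ t, m {t} = 0)
    (hpos : ∀ a b : ℝ, 0 ≤ a → a < b → 0 < m (Ioo a b)) {v : ℝ} (hv : v ∈ Ioo (0 : ℝ) 1) :
    quantile m v ≠ ∞ := by
  intro h
  have := distFun_quantile hm ha hpos ⟨hv.1.le, hv.2.le⟩
  rw [h, distFun_top] at this
  exact hv.2.ne' this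

/-- Inverse transform sampling: for `v` in `(0,1)`, `Q₀(v) ≤ x` exactly when `v ≤ F₀(x)`, so the
pushforward has the right distribution function. -/
theorem map_quantile (hm : m (Iic 0) = 0) (ha : ∀ t, m {t} = 0)
    (hpos : ∀ a b : ℝ, 0 ≤ a → a < b → 0 < m (Ioo a b)) :
    (volume.restrict (Ioo (0 : ℝ) 1)).map (fun v => (quantile m v).toReal) = m := by
  have hmeas : Measurable fun v => (quantile m v).toReal := quantile_mono.measurable.ennreal_toReal
  refine Measure.ext_of_Iic _ _ fun x => ?_
  rw [Measure.map_apply hmeas measurableSet_Iic,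
    Measure.restrict_apply (hmeas measurableSet_Iic)]
  rcases lt_or_ge x 0 with hx | hx
  · rw [measure_mono_null (Iic_subset_Iic.2 hx.le) hm]
    convert measure_empty (μ := (volume : Measure ℝ))
    ext v
    simp only [mem_inter_iff, mem_preimage, mem_Iic, mem_empty_iff_false, iff_false, not_and]
    intro h
    exact absurd (ENNReal.toReal_nonneg.trans h) (not_le.2 hx)
  · have hF : m (Iic x) = ENNReal.ofReal (distFun m (ENNReal.ofReal x)) := by
      rw [distFun_ofReal hx, ofReal_measureReal]
    have hset : (fun v => (quantile m v).toReal) ⁻¹' Iic x ∩ Ioo 0 1 =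
        Ioo 0 1 ∩ Iic (distFun m (ENNReal.ofReal x)) := by
      ext v
      simp only [mem_inter_iff, mem_preimage, mem_Iic]
      rw [and_comm]
      refine and_congr_right fun hv => ?_
      rw [← ENNReal.le_ofReal_iff_toReal_le (quantile_ne_top hm ha hpos hv) hx,
        ← (distFun_strictMono hpos).le_iff_le, distFun_quantile hm ha hpos ⟨hv.1.le, hv.2.le⟩]
    rw [hset, hF, inter_comm, ← Measure.restrict_apply measurableSet_Iic,
      restrict_Ioo_eq_restrict_Ioc, Measure.restrict_apply measurableSet_Iic, inter_comm,
      Ioc_inter_Iic, Real.volume_Ioc, min_eq_right (distFun_mem_Icc _).2, sub_zero]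

end Quantile

/-! ### Box volumes in dimensions two and three -/

theorem sum_finset_fin_two (g : Finset (Fin 2) → ℝ) :
    ∑ s, g s = g ∅ + g {0} + g {1} + g {0, 1} := by
  have h : (Finset.univ : Finset (Finset (Fin 2))) = {∅, {0}, {1}, {0, 1}} := by decide
  rw [h, Finset.sum_insert (by decide), Finset.sum_insert (by decide),
    Finset.sum_insert (by decide), Finset.sum_singleton]
  ring

theorem sum_finset_fin_three (g : Finset (Fin 3) → ℝ) :
    ∑ s, g s = g ∅ + g {0} + g {1} + g {2} + g {0, 1} + g {0, 2} + g {1, 2} + g {0, 1, 2} := by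
  have h : (Finset.univ : Finset (Finset (Fin 3))) =
      {∅, {0}, {1}, {2}, {0, 1}, {0, 2}, {1, 2}, {0, 1, 2}} := by decide
  rw [h, Finset.sum_insert (by decide), Finset.sum_insert (by decide),
    Finset.sum_insert (by decide), Finset.sum_insert (by decide), Finset.sum_insert (by decide),
    Finset.sum_insert (by decide), Finset.sum_insert (by decide), Finset.sum_singleton]
  ring

/-- The volume of a box in dimension two. -/
theorem sum_volume_fin_two (L : ℝ → ℝ → ℝ) (a b : Fin 2 → ℝ) :
    ∑ s : Finset (Fin 2), (-1 : ℝ) ^ s.card *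
      (fun w : Fin 2 → ℝ => L (w 0) (w 1)) (fun i => if i ∈ s then a i else b i) =
    L (b 0) (b 1) - L (a 0) (b 1) - L (b 0) (a 1) + L (a 0) (a 1) := by
  rw [sum_finset_fin_two]
  simp
  ring

/-- The volume of a box in dimension three. -/
theorem sum_volume_fin_three (L : ℝ → ℝ → ℝ → ℝ) (a b : Fin 3 → ℝ) :
    ∑ s : Finset (Fin 3), (-1 : ℝ) ^ s.card *
      (fun w : Fin 3 → ℝ => L (w 0) (w 1) (w 2)) (fun i => if i ∈ s then a i else b i) =
    (L (b 0) (b 1) (b 2) - L (a 0) (b 1) (b 2) - L (b 0) (a 1) (b 2) + L (a 0) (a 1) (b 2)) -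
    (L (b 0) (b 1) (a 2) - L (a 0) (b 1) (a 2) - L (b 0) (a 1) (a 2) + L (a 0) (a 1) (a 2)) := by
  rw [sum_finset_fin_three]
  simp
  ring

/-! ### The linking copulas -/

theorem measurable_expNeg_quantile_mul {m : Measure ℝ} (s : ℝ≥0∞) :
    Measurable fun w => expNeg (quantile m w * s) :=
  continuous_expNeg.measurable.comp (quantile_mono.measurable.mul_const s)

theorem intervalIntegrable_expNeg_quantile_mul {m : Measure ℝ} (s : ℝ≥0∞) (a b : ℝ) :
    IntervalIntegrable (fun w => expNeg (quantile m w * s)) volume a b := by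
  rw [intervalIntegrable_iff, IntegrableOn, uIoc]
  exact Integrable.of_bound (measurable_expNeg_quantile_mul s).aestronglyMeasurable 1
    (ae_of_all _ fun _ => norm_expNeg_le_one _)

section Link

variable {m : Measure ℝ} [IsProbabilityMeasure m]

theorem ofReal_toReal_quantile (hm : m (Iic 0) = 0) (ha : ∀ t, m {t} = 0)
    (hpos : ∀ a b : ℝ, 0 ≤ a → a < b → 0 < m (Ioo a b)) {v : ℝ} (hv : v ∈ Ioo (0 : ℝ) 1) :
    ENNReal.ofReal (quantile m v).toReal = quantile m v :=
  ENNReal.ofReal_toReal (quantile_ne_top hm ha hpos hv)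

/-- The change of variables `t = Q₀(w)`, which turns the domain `t ≤ Q₀(v)` into `w ≤ v`. -/
theorem setIntegral_eq_integral_quantile (hm : m (Iic 0) = 0) (ha : ∀ t, m {t} = 0)
    (hpos : ∀ a b : ℝ, 0 ≤ a → a < b → 0 < m (Ioo a b)) (s : ℝ≥0∞) {v : ℝ}
    (hv : v ∈ Icc (0 : ℝ) 1) :
    ∫ t in {t : ℝ | 0 ≤ t ∧ ENNReal.ofReal t ≤ quantile m v}, expNeg (ENNReal.ofReal t * s) ∂m =
      ∫ w in (0 : ℝ)..v, expNeg (quantile m w * s) := by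
  have hmeas : Measurable fun v => (quantile m v).toReal := quantile_mono.measurable.ennreal_toReal
  have hset : MeasurableSet {t : ℝ | 0 ≤ t ∧ ENNReal.ofReal t ≤ quantile m v} :=
    measurableSet_Ici.inter (measurableSet_ofReal_le _)
  have hmap := setIntegral_map hset (measurable_expNeg_mul s).aestronglyMeasurable
    (μ := volume.restrict (Ioo (0 : ℝ) 1)) hmeas.aemeasurable
  rw [map_quantile hm ha hpos] at hmap
  rw [hmap, Measure.restrict_restrict (hmeas hset), intervalIntegral.integral_of_le hv.1]
  have hpre : (fun v => (quantile m v).toReal) ⁻¹'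
      {t : ℝ | 0 ≤ t ∧ ENNReal.ofReal t ≤ quantile m v} ∩ Ioo 0 1 = Iic v ∩ Ioo 0 1 := by
    ext w
    simp only [mem_inter_iff, mem_Iic]
    refine and_congr_left fun hw => ?_
    show 0 ≤ (quantile m w).toReal ∧ ENNReal.ofReal (quantile m w).toReal ≤ quantile m v ↔ w ≤ v
    rw [ofReal_toReal_quantile hm ha hpos hw, ← (distFun_strictMono hpos).le_iff_le,
      distFun_quantile hm ha hpos hv, distFun_quantile hm ha hpos ⟨hw.1.le, hw.2.le⟩]
    simp
  have hIoc : volume.restrict (Iic v ∩ Ioo (0 : ℝ) 1) = volume.restrict (Ioc 0 v) := by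
    rw [← Measure.restrict_restrict measurableSet_Iic, restrict_Ioo_eq_restrict_Ioc,
      Measure.restrict_restrict measurableSet_Iic, inter_comm, Ioc_inter_Iic, min_eq_right hv.2]
  rw [hpre, ← hIoc]
  refine setIntegral_congr_fun (measurableSet_Iic.inter measurableSet_Ioo) fun w hw => ?_
  simp only [ofReal_toReal_quantile hm ha hpos hw.2]

theorem laplace_eq_integral_quantile (hm : m (Iic 0) = 0) (ha : ∀ t, m {t} = 0)
    (hpos : ∀ a b : ℝ, 0 ≤ a → a < b → 0 < m (Ioo a b)) (s : ℝ≥0∞) :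
    laplace m s = ∫ w in (0 : ℝ)..1, expNeg (quantile m w * s) := by
  rw [← setIntegral_eq_integral_quantile hm ha hpos s ⟨zero_le_one, le_rfl⟩, laplace,
    quantile_one hpos]
  simp [Ici_def]

theorem archimedeanLink_eq_integral (hm : m (Iic 0) = 0) (ha : ∀ t, m {t} = 0)
    (hpos : ∀ a b : ℝ, 0 ≤ a → a < b → 0 < m (Ioo a b)) (u : ℝ) {v : ℝ}
    (hv : v ∈ Icc (0 : ℝ) 1) :
    archimedeanLink m u v = ∫ w in (0 : ℝ)..v, expNeg (quantile m w * laplaceInv m u) :=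
  setIntegral_eq_integral_quantile hm ha hpos _ hv

theorem deriv_archimedeanLink (hm : m (Iic 0) = 0) (ha : ∀ t, m {t} = 0)
    (hpos : ∀ a b : ℝ, 0 ≤ a → a < b → 0 < m (Ioo a b)) (u : ℝ) {v : ℝ}
    (hv : v ∈ Ioo (0 : ℝ) 1) :
    deriv (fun t => archimedeanLink m u t) v = expNeg (quantile m v * laplaceInv m u) := by
  have hev : (fun t => archimedeanLink m u t) =ᶠ[nhds v]
      fun t => ∫ w in (0 : ℝ)..t, expNeg (quantile m w * laplaceInv m u) := by
    filter_upwards [Ioo_mem_nhds hv.1 hv.2] with t ht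
    exact archimedeanLink_eq_integral hm ha hpos u ⟨ht.1.le, ht.2.le⟩
  rw [hev.deriv_eq]
  refine (intervalIntegral.integral_hasDerivAt_right
    (intervalIntegrable_expNeg_quantile_mul _ _ _)
    (measurable_expNeg_quantile_mul _).stronglyMeasurable.stronglyMeasurableAtFilter ?_).deriv
  -- `laplaceInv m u` may be `∞`; multiplication by `∞` is discontinuous only at `0`, and `Q₀(v) ≠
  -- 0`.
  exact continuous_expNeg.continuousAt.comp
    (ContinuousAt.comp (f := quantile m) (g := fun x => x * laplaceInv m u)
      (ENNReal.continuousAt_mul_const (Or.inr (quantile_pos hm ha hpos hv)))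
      (continuous_quantile hpos).continuousAt)

theorem isBivariateCopula_archimedeanLink (hm : m (Iic 0) = 0) (ha : ∀ t, m {t} = 0)
    (hpos : ∀ a b : ℝ, 0 ≤ a → a < b → 0 < m (Ioo a b)) :
    IsBivariateCopula (archimedeanLink m) where
  grounded := by
    intro u hu ⟨i, hi⟩
    rw [archimedeanLink_eq_integral hm ha hpos _ (hu 1)]
    fin_cases i
    · simp only [Fin.zero_eta] at hi
      rw [hi, laplaceInv_zero hm]
      -- The integrand vanishes only on the open interval: at `w = 0` the convention `0 * ∞ = 0`
      -- makes it `1`.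
      rw [intervalIntegral.integral_congr_Ioo_of_le (g := fun _ => 0) (hu 1).1]
      · simp
      · intro w hw
        have hw' : w ∈ Ioo (0 : ℝ) 1 := ⟨hw.1, hw.2.trans_le (hu 1).2⟩
        simp [ENNReal.mul_top, quantile_pos hm ha hpos hw', expNeg_top]
    · simp only [Fin.mk_one] at hi
      rw [hi, intervalIntegral.integral_same]
  margin := by
    intro i x hx
    fin_cases i
    · simp only [Fin.zero_eta, Function.update_self, ne_eq, one_ne_zero, not_false_eq_true,
        Function.update_of_ne]
      rw [archimedeanLink_eq_integral hm ha hpos _ ⟨zero_le_one, le_rfl⟩,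
        ← laplace_eq_integral_quantile hm ha hpos, laplace_laplaceInv hm hx]
    · simp only [Fin.mk_one, Function.update_self, ne_eq, zero_ne_one, not_false_eq_true,
        Function.update_of_ne]
      rw [archimedeanLink_eq_integral hm ha hpos _ hx, laplaceInv_one hm]
      simp [expNeg_zero]
  increasing := by
    intro a b ha' hb' hab
    rw [sum_volume_fin_two]
    simp only [archimedeanLink_eq_integral hm ha hpos _ (ha' 1),
      archimedeanLink_eq_integral hm ha hpos _ (hb' 1)]
    have key : ∀ u : ℝ, (∫ w in (0 : ℝ)..b 1, expNeg (quantile m w * laplaceInv m u)) =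
        (∫ w in (0 : ℝ)..a 1, expNeg (quantile m w * laplaceInv m u)) +
          ∫ w in a 1..b 1, expNeg (quantile m w * laplaceInv m u) := fun u =>
      (intervalIntegral.integral_add_adjacent_intervals
        (intervalIntegrable_expNeg_quantile_mul _ _ _)
        (intervalIntegrable_expNeg_quantile_mul _ _ _)).symm
    rw [key (b 0), key (a 0)]
    have := intervalIntegral.integral_mono (hab 1)
      (intervalIntegrable_expNeg_quantile_mul (m := m) (laplaceInv m (a 0)) (a 1) (b 1))
      (intervalIntegrable_expNeg_quantile_mul (laplaceInv m (b 0)) (a 1) (b 1))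
      (fun w => expNeg_strictAnti.antitone
        (mul_le_mul_right (laplaceInv_le_laplaceInv hm (ha' 0) (hb' 0) (hab 0)) (quantile m w)))
    linarith

end Link

/-! ### From second differences of `f` to those of `exp(-x f)` -/

/-- `f` has nonpositive second differences in the finite range: the volume of `f (a + b)` on every
finite box is nonpositive. -/
def SubmodularSum (f : ℝ≥0∞ → ℝ≥0∞) : Prop :=
  ∀ a a' b b' : ℝ≥0∞, a ≤ a' → b ≤ b' → a' ≠ ∞ → b' ≠ ∞ →
    f (a + b) + f (a' + b') ≤ f (a' + b) + f (a + b')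

/-- If `p ≤ q`, `p ≤ r` and `p + z ≤ q + r`, then `e^{-p} + e^{-z} ≥ e^{-q} + e^{-r}`. -/
theorem expNeg_second_difference_nonneg {p q r z : ℝ≥0∞} (hpq : p ≤ q) (hpr : p ≤ r)
    (hp : p ≠ ∞) (h : p + z ≤ q + r) :
    0 ≤ expNeg p - expNeg q - expNeg r + expNeg z := by
  obtain ⟨α, rfl⟩ := exists_add_of_le hpq
  obtain ⟨β, rfl⟩ := exists_add_of_le hpr
  have hz : z ≤ p + α + β := by
    rw [← ENNReal.add_le_add_iff_left hp]
    calc p + z ≤ p + α + (p + β) := h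
      _ = p + (p + α + β) := by ring
  have h1 := expNeg_strictAnti.antitone hz
  simp only [expNeg_add] at h1 ⊢
  -- With `q = p + α`, `r = p + β` and `z` replaced by its upper bound `p + α + β`, the expression
  -- factors into this product.
  have h2 : 0 ≤ expNeg p * ((1 - expNeg α) * (1 - expNeg β)) :=
    mul_nonneg (expNeg_nonneg p)
      (mul_nonneg (sub_nonneg.2 (expNeg_le_one α)) (sub_nonneg.2 (expNeg_le_one β)))
  linarith

/-- For increasing `f` with nonpositive second differences, `e^{-x f}` has nonnegative second
differences on `[0,∞]`. -/
theorem SubmodularSum.expNeg_nonneg {f : ℝ≥0∞ → ℝ≥0∞} (hf : SubmodularSum f) (hmono : Monotone f)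
    (hfin : ∀ s, s ≠ ∞ → f s ≠ ∞) {x : ℝ≥0∞} (hx : x ≠ ∞) {a a' b b' : ℝ≥0∞} (haa : a ≤ a')
    (hbb : b ≤ b') :
    0 ≤ expNeg (x * f (a + b)) - expNeg (x * f (a' + b)) - expNeg (x * f (a + b')) +
      expNeg (x * f (a' + b')) := by
  have hanti : ∀ {s t : ℝ≥0∞}, s ≤ t → expNeg (x * f t) ≤ expNeg (x * f s) := fun hst =>
    expNeg_strictAnti.antitone (mul_le_mul_right (hmono hst) x)
  -- At an infinite corner the two terms containing it cancel, and monotonicity settles the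
  -- remaining two.
  by_cases ha : a' = ∞
  · subst ha
    have := hanti (add_le_add_right hbb a)
    simp only [top_add]
    linarith
  by_cases hb : b' = ∞
  · subst hb
    have := hanti (add_le_add_left haa b)
    simp only [add_top]
    linarith
  refine expNeg_second_difference_nonneg (mul_le_mul_right (hmono (add_le_add_left haa b)) x)
    (mul_le_mul_right (hmono (add_le_add_right hbb a)) x)
    (ENNReal.mul_ne_top hx (hfin _ (ENNReal.add_ne_top.2
      ⟨ne_top_of_le_ne_top ha haa, ne_top_of_le_ne_top hb hbb⟩))) ?_
  rw [← mul_add, ← mul_add]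
  exact mul_le_mul_right (hf a a' b b' haa hbb ha hb) x

/-! ### Recovering the sign by exponential tilting -/

/-- Exponential tilting detects the sign of a bounded function to the right of the origin. -/
theorem exists_integral_exp_mul_pos {m : Measure ℝ} [IsProbabilityMeasure m]
    (hm : m (Iic 0) = 0) (hpos : ∀ a b : ℝ, 0 ≤ a → a < b → 0 < m (Ioo a b)) {k : ℝ → ℝ}
    (hk : Measurable k) {M : ℝ} (hM : ∀ t, 0 < t → |k t| ≤ M) {ε : ℝ} (hε : 0 < ε)
    (hkε : ∀ t ∈ Ioo 0 ε, 0 < k t) :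
    ∃ c : ℝ, 0 ≤ c ∧ 0 < ∫ t, Real.exp (-(t * c)) * k t ∂m := by
  have hae := ae_pos_of_measure_Iic hm
  have hkint : Integrable k m := Integrable.of_bound hk.aestronglyMeasurable M
    (hae.mono fun t ht => hM t ht)
  have hM0 : 0 ≤ M := (abs_nonneg _).trans (hM 1 one_pos)
  have hK : 0 < ∫ t in Ioo 0 (ε / 2), k t ∂m := by
    rw [setIntegral_pos_iff_support_of_nonneg_ae]
    · refine (hpos 0 (ε / 2) le_rfl (by linarith)).trans_le (measure_mono fun t ht => ?_)
      exact ⟨(hkε t ⟨ht.1, by linarith [ht.2]⟩).ne', ht⟩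
    · filter_upwards [ae_restrict_mem measurableSet_Ioo] with t ht
      exact (hkε t ⟨ht.1, by linarith [ht.2]⟩).le
    · exact hkint.integrableOn
  set K := ∫ t in Ioo 0 (ε / 2), k t ∂m with hKdef
  -- The part below `ε / 2` contributes at least `K * exp(-cε/2)`, the tail beyond `ε` at least `-M
  -- * exp(-cε)`. Their sum is positive for this `c`; the part in between is nonnegative.
  obtain ⟨c, hc0, hc⟩ : ∃ c : ℝ, 0 ≤ c ∧ M * Real.exp (-(c * (ε / 2))) < K := by
    have ht : Filter.Tendsto (fun c : ℝ => M * Real.exp (-(c * (ε / 2)))) Filter.atTop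
        (nhds (M * 0)) :=
      (Real.tendsto_exp_neg_atTop_nhds_zero.comp
        (Filter.tendsto_id.atTop_mul_const (by linarith : 0 < ε / 2))).const_mul M
    rw [mul_zero] at ht
    exact ((Filter.eventually_ge_atTop 0).and (ht.eventually (gt_mem_nhds hK))).exists
  refine ⟨c, hc0, ?_⟩
  have hint : Integrable (fun t => Real.exp (-(t * c)) * k t) m := by
    refine Integrable.of_bound (by fun_prop) M (hae.mono fun t ht => ?_)
    rw [norm_mul, Real.norm_of_nonneg (Real.exp_pos _).le]
    have : Real.exp (-(t * c)) ≤ 1 := Real.exp_le_one_iff.2 (by nlinarith)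
    calc _ ≤ 1 * M := mul_le_mul this (hM t ht) (abs_nonneg _) zero_le_one
      _ = M := one_mul M
  have hind : Integrable ((Ioo 0 (ε / 2)).indicator k) m := hkint.indicator measurableSet_Ioo
  have hle : ∫ t, (Real.exp (-(c * (ε / 2))) * (Ioo 0 (ε / 2)).indicator k t -
      M * Real.exp (-(c * ε))) ∂m ≤ ∫ t, Real.exp (-(t * c)) * k t ∂m := by
    refine integral_mono_ae ((hind.const_mul _).sub (integrable_const _)) hint ?_
    filter_upwards [hae] with t ht
    have hMe : 0 ≤ M * Real.exp (-(c * ε)) := by positivity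
    by_cases h1 : t < ε / 2
    · have hmem : t ∈ Ioo 0 (ε / 2) := ⟨ht, h1⟩
      have hk0 := hkε t ⟨ht, by linarith⟩
      have : Real.exp (-(c * (ε / 2))) ≤ Real.exp (-(t * c)) :=
        Real.exp_le_exp.2 (by nlinarith)
      have := mul_le_mul_of_nonneg_right this hk0.le
      simp only [indicator_of_mem hmem]
      linarith
    · have hmem : t ∉ Ioo 0 (ε / 2) := fun h => h1 h.2
      simp only [indicator_of_notMem hmem, mul_zero, zero_sub]
      by_cases h2 : t < ε
      · have := mul_pos (Real.exp_pos (-(t * c))) (hkε t ⟨ht, h2⟩)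
        linarith
      · have h3 : Real.exp (-(t * c)) ≤ Real.exp (-(c * ε)) := Real.exp_le_exp.2 (by nlinarith)
        have h4 : -M ≤ k t := (abs_le.1 (hM t ht)).1
        have h5 := mul_le_mul_of_nonneg_left h4 (Real.exp_pos (-(t * c))).le
        have h6 := mul_le_mul_of_nonneg_left h3 hM0
        linarith
  rw [integral_sub (hind.const_mul _) (integrable_const _), integral_const_mul,
    integral_indicator measurableSet_Ioo, ← hKdef] at hle
  simp only [integral_const, probReal_univ, smul_eq_mul, one_mul] at hle
  have hsq : Real.exp (-(c * ε)) = Real.exp (-(c * (ε / 2))) * Real.exp (-(c * (ε / 2))) := by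
    rw [← Real.exp_add]; congr 1; ring
  have := mul_pos (Real.exp_pos (-(c * (ε / 2)))) (sub_pos.2 hc)
  rw [hsq] at hle
  linarith

/-- If all exponential tilts of `e^{-tp} - e^{-tq} - e^{-tr} + e^{-tz}` have nonnegative integral,
then `p + z ≤ q + r`. -/
theorem add_le_add_of_integral_nonneg {m : Measure ℝ} [IsProbabilityMeasure m]
    (hm : m (Iic 0) = 0) (hpos : ∀ a b : ℝ, 0 ≤ a → a < b → 0 < m (Ioo a b)) {p q r z : ℝ}
    (hp : 0 ≤ p) (hq : 0 ≤ q) (hr : 0 ≤ r) (hz : 0 ≤ z)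
    (h : ∀ c : ℝ, 0 ≤ c → 0 ≤ ∫ t, Real.exp (-(t * c)) * (Real.exp (-(t * p)) -
      Real.exp (-(t * q)) - Real.exp (-(t * r)) + Real.exp (-(t * z))) ∂m) :
    p + z ≤ q + r := by
  by_contra! hlt
  set k : ℝ → ℝ := fun t => -(Real.exp (-(t * p)) - Real.exp (-(t * q)) - Real.exp (-(t * r)) +
    Real.exp (-(t * z))) with hkdef
  have hexp : ∀ x : ℝ, HasDerivAt (fun t => Real.exp (-(t * x))) (-x) 0 := fun x => by
    simpa using (((hasDerivAt_id (0 : ℝ)).mul_const x).neg).exp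
  -- Since `k 0 = 0`, the positive derivative forces `k > 0` just to the right of `0`, which
  -- contradicts `h` for some tilt.
  have hd : HasDerivAt k (p + z - q - r) 0 := by
    exact ((((hexp p).sub (hexp q)).sub (hexp r)).add (hexp z)).neg.congr_deriv (by ring)
  have hk0 : k 0 = 0 := by simp [hkdef]
  have hev : ∀ᶠ t in nhdsWithin (0 : ℝ) {0}ᶜ, 0 < slope k 0 t :=
    (hasDerivAt_iff_tendsto_slope.1 hd).eventually (lt_mem_nhds (by linarith))
  rw [eventually_nhdsWithin_iff, Metric.eventually_nhds_iff] at hev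
  obtain ⟨ε, hε, hball⟩ := hev
  have hkε : ∀ t ∈ Ioo 0 ε, 0 < k t := by
    intro t ht
    have h1 := hball (by simpa [abs_of_pos ht.1] using ht.2) (show t ∈ ({0} : Set ℝ)ᶜ from ht.1.ne')
    rw [slope_def_field, hk0, sub_zero, sub_zero] at h1
    exact (div_pos_iff_of_pos_right ht.1).1 h1
  have hb : ∀ t x : ℝ, 0 < t → 0 ≤ x → Real.exp (-(t * x)) ≤ 1 := fun t x ht hx =>
    Real.exp_le_one_iff.2 (by nlinarith)
  obtain ⟨c, hc, hci⟩ := exists_integral_exp_mul_pos hm hpos (k := k) (M := 2)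
    (by fun_prop) (fun t ht => by
      have h1 := hb t p ht hp
      have h2 := hb t q ht hq
      have h3 := hb t r ht hr
      have h4 := hb t z ht hz
      have h5 := Real.exp_pos (-(t * p))
      have h6 := Real.exp_pos (-(t * q))
      have h7 := Real.exp_pos (-(t * r))
      have h8 := Real.exp_pos (-(t * z))
      rw [abs_le]
      constructor <;> simp only [hkdef] <;> linarith) hε hkε
  simp only [hkdef, mul_neg, integral_neg] at hci
  linarith [h c hc]

/-! ### Concavity implies submodularity -/

/-- A concave function on `(0,∞)` has nonpositive second differences. -/
theorem second_difference_le_of_concaveOn {g : ℝ → ℝ} (hg : ConcaveOn ℝ (Ioi 0) g) {s x y : ℝ}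
    (hs : 0 < s) (hx : 0 ≤ x) (hy : 0 ≤ y) : g s + g (s + x + y) ≤ g (s + x) + g (s + y) := by
  rcases (add_nonneg hx hy).eq_or_lt with h | h
  · have hx0 : x = 0 := by linarith
    have hy0 : y = 0 := by linarith
    simp [hx0, hy0]
  have hmem : s ∈ Ioi (0 : ℝ) := hs
  have hmem' : s + x + y ∈ Ioi (0 : ℝ) := by show 0 < s + x + y; linarith
  have hsum : y / (x + y) + x / (x + y) = 1 := by field_simp; ring
  have h1 := hg.2 hmem hmem' (div_nonneg hy h.le) (div_nonneg hx h.le) hsum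
  have h2 := hg.2 hmem hmem' (div_nonneg hx h.le) (div_nonneg hy h.le) (by rw [add_comm, hsum])
  -- Both inner points are convex combinations of the endpoints, with swapped weights; adding the
  -- two concavity inequalities gives the claim.
  have e1 : (y / (x + y)) • s + (x / (x + y)) • (s + x + y) = s + x := by
    simp only [smul_eq_mul]; field_simp; ring
  have e2 : (x / (x + y)) • s + (y / (x + y)) • (s + x + y) = s + y := by
    simp only [smul_eq_mul]; field_simp; ring
  rw [e1] at h1
  rw [e2] at h2
  simp only [smul_eq_mul] at h1 h2
  have : (y / (x + y) + x / (x + y)) * (g s + g (s + x + y)) ≤ g (s + x) + g (s + y) := by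
    linarith
  rwa [hsum, one_mul] at this

/-- A nonnegative concave function on `(0,∞)` is subadditive. -/
theorem subadditive_of_concaveOn {g : ℝ → ℝ} (hg : ConcaveOn ℝ (Ioi 0) g)
    (h0 : ∀ s, 0 ≤ g s) {x y : ℝ} (hx : 0 < x) (hy : 0 < y) : g (x + y) ≤ g x + g y := by
  have hcont : ContinuousAt g (x + y) :=
    (hg.continuousOn isOpen_Ioi).continuousAt (Ioi_mem_nhds (by linarith))
  have ht : Filter.Tendsto (fun δ : ℝ => g (x + y - δ)) (nhdsWithin 0 (Ioi 0))
      (nhds (g (x + y))) := by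
    refine Filter.Tendsto.mono_left ?_ nhdsWithin_le_nhds
    have : Filter.Tendsto (fun δ : ℝ => x + y - δ) (nhds 0) (nhds (x + y)) := by
      have h : Continuous fun δ : ℝ => x + y - δ := by fun_prop
      simpa using h.tendsto 0
    exact hcont.tendsto.comp this
  -- Concavity is known only on the open half-line, so second differences are based at `δ > 0`; `g δ
  -- ≥ 0` is dropped and `δ` tends to `0`.
  refine le_of_tendsto ht ?_
  filter_upwards [Ioo_mem_nhdsGT (lt_min hx hy)] with δ hδ
  have hδx := hδ.2.trans_le (min_le_left x y)
  have hδy := hδ.2.trans_le (min_le_right x y)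
  have h := second_difference_le_of_concaveOn hg hδ.1 (sub_nonneg.2 hδx.le) (sub_nonneg.2 hδy.le)
  have e1 : δ + (x - δ) + (y - δ) = x + y - δ := by ring
  have e2 : δ + (x - δ) = x := by ring
  have e3 : δ + (y - δ) = y := by ring
  rw [e1, e2, e3] at h
  linarith [h0 δ]

/-- A positive base point `a + b` is covered by the second-difference inequality. At base point `0`,
outside the domain of concavity, `f 0 = 0` reduces the claim to subadditivity. -/
theorem submodularSum_of_concaveOn {f : ℝ≥0∞ → ℝ≥0∞} (hzero : f 0 = 0)
    (hfin : ∀ s, s ≠ ∞ → f s ≠ ∞)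
    (hg : ConcaveOn ℝ (Ioi 0) fun s => (f (ENNReal.ofReal s)).toReal) : SubmodularSum f := by
  intro a a' b b' haa hbb ha' hb'
  obtain ⟨x, rfl⟩ := exists_add_of_le haa
  obtain ⟨y, rfl⟩ := exists_add_of_le hbb
  obtain ⟨ha, hx⟩ := ENNReal.add_ne_top.1 ha'
  obtain ⟨hb, hy⟩ := ENNReal.add_ne_top.1 hb'
  have hs : a + b ≠ ∞ := ENNReal.add_ne_top.2 ⟨ha, hb⟩
  have e1 : a + x + b = a + b + x := by ring
  have e2 : a + (b + y) = a + b + y := by ring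
  have e3 : a + x + (b + y) = a + b + x + y := by ring
  rw [e1, e2, e3]
  generalize a + b = s at hs
  have hfr : ∀ t : ℝ≥0∞, t ≠ ∞ → (f (ENNReal.ofReal t.toReal)).toReal = (f t).toReal :=
    fun t ht => by rw [ENNReal.ofReal_toReal ht]
  have hsx : s + x ≠ ∞ := ENNReal.add_ne_top.2 ⟨hs, hx⟩
  have hsy : s + y ≠ ∞ := ENNReal.add_ne_top.2 ⟨hs, hy⟩
  have hsxy : s + x + y ≠ ∞ := ENNReal.add_ne_top.2 ⟨hsx, hy⟩
  by_cases hs0 : s = 0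
  · subst hs0
    by_cases hx0 : x = 0
    · simp [hx0]
    by_cases hy0 : y = 0
    · simp [hy0, add_comm]
    have h := subadditive_of_concaveOn hg (fun _ => ENNReal.toReal_nonneg)
      (ENNReal.toReal_pos hx0 hx) (ENNReal.toReal_pos hy0 hy)
    simp only [zero_add] at hsxy
    rw [← ENNReal.toReal_add hx hy, hfr _ hsxy, hfr _ hx, hfr _ hy,
      ← ENNReal.toReal_add (hfin _ hx) (hfin _ hy), ENNReal.toReal_le_toReal (hfin _ hsxy)
        (ENNReal.add_ne_top.2 ⟨hfin _ hx, hfin _ hy⟩)] at h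
    simpa [hzero] using h
  · have h := second_difference_le_of_concaveOn hg (ENNReal.toReal_pos hs0 hs)
      (ENNReal.toReal_nonneg (a := x)) (ENNReal.toReal_nonneg (a := y))
    rw [← ENNReal.toReal_add hs hx, ← ENNReal.toReal_add hs hy, ← ENNReal.toReal_add hsx hy,
      hfr _ hs, hfr _ hsx, hfr _ hsy, hfr _ hsxy,
      ← ENNReal.toReal_add (hfin _ hs) (hfin _ hsxy),
      ← ENNReal.toReal_add (hfin _ hsx) (hfin _ hsy), ENNReal.toReal_le_toReal
        (ENNReal.add_ne_top.2 ⟨hfin _ hs, hfin _ hsxy⟩)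
        (ENNReal.add_ne_top.2 ⟨hfin _ hsx, hfin _ hsy⟩)] at h
    exact h

/-! ### The one-factor representation of `N` -/

theorem integrable_expNeg_second_difference (m : Measure ℝ) [IsFiniteMeasure m]
    (p q r z : ℝ≥0∞) :
    Integrable (fun t => expNeg (ENNReal.ofReal t * p) - expNeg (ENNReal.ofReal t * q) -
      expNeg (ENNReal.ofReal t * r) + expNeg (ENNReal.ofReal t * z)) m :=
  (((integrable_expNeg_mul m p).sub (integrable_expNeg_mul m q)).sub
    (integrable_expNeg_mul m r)).add (integrable_expNeg_mul m z)

theorem laplace_second_difference {m : Measure ℝ} [IsProbabilityMeasure m] (hm : m (Iic 0) = 0)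
    (p q r z : ℝ≥0∞) :
    laplace m p - laplace m q - laplace m r + laplace m z =
      ∫ t, (expNeg (ENNReal.ofReal t * p) - expNeg (ENNReal.ofReal t * q) -
        expNeg (ENNReal.ofReal t * r) + expNeg (ENNReal.ofReal t * z)) ∂m := by
  have hI := integrable_expNeg_mul m
  have hpq : Integrable
      (fun t => expNeg (ENNReal.ofReal t * p) - expNeg (ENNReal.ofReal t * q)) m :=
    (hI p).sub (hI q)
  have hpqr : Integrable (fun t => expNeg (ENNReal.ofReal t * p) - expNeg (ENNReal.ofReal t * q) -
    expNeg (ENNReal.ofReal t * r)) m := hpq.sub (hI r)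
  rw [integral_add hpqr (hI z), integral_sub hpq (hI r), integral_sub (hI p) (hI q)]
  simp only [laplace_eq_integral hm]

theorem ofReal_mul_ofReal_one_div_mul {x : ℝ} (hx : 0 < x) (s : ℝ≥0∞) :
    ENNReal.ofReal x * (ENNReal.ofReal (1 / x) * s) = s := by
  rw [← mul_assoc, ← ENNReal.ofReal_mul hx.le, mul_one_div_cancel hx.ne', ENNReal.ofReal_one,
    one_mul]

theorem ofReal_one_div_mul_ofReal_mul {x : ℝ} (hx : 0 < x) (s : ℝ≥0∞) :
    ENNReal.ofReal (1 / x) * (ENNReal.ofReal x * s) = s := by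
  rw [mul_left_comm, ofReal_mul_ofReal_one_div_mul hx]

theorem logInv_anti {u v : ℝ} (hu : u ∈ Icc (0 : ℝ) 1) (hv : v ∈ Icc (0 : ℝ) 1) (huv : u ≤ v) :
    logInv v ≤ logInv u := by
  rwa [← expNeg_strictAnti.le_iff_ge, expNeg_logInv hu, expNeg_logInv hv]

theorem logInv_zero : logInv 0 = ∞ := by simp [logInv]

theorem logInv_one : logInv 1 = 0 := by simp [logInv]

theorem hasEOFCRepresentation_nestedArchimedean {m₁ m₂ : Measure ℝ}
    [IsProbabilityMeasure m₁] (h₁ : m₁ (Iic 0) = 0) (ha : ∀ t, m₁ {t} = 0)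
    (hpos : ∀ a b : ℝ, 0 ≤ a → a < b → 0 < m₁ (Ioo a b)) :
    HasEOFCRepresentation (fun u₀ => nestedInner m₁ m₂ (quantile m₁ u₀).toReal)
      (fun _ => archimedeanLink m₁) (nestedArchimedean m₁ m₂) := by
  intro u hu
  set X : ℝ≥0∞ := laplaceInv m₁ (laplace m₂ (laplaceInv m₂ (u 0) + laplaceInv m₂ (u 1))) +
    laplaceInv m₁ (u 2) with hX
  have heq : EqOn (fun v => expNeg (quantile m₁ v * X))
      (eofcIntegrand (fun u₀ => nestedInner m₁ m₂ (quantile m₁ u₀).toReal)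
        (fun _ => archimedeanLink m₁) u) (Ioo 0 1) := by
    intro v hv
    have hx : 0 < (quantile m₁ v).toReal :=
      ENNReal.toReal_pos (quantile_pos h₁ ha hpos hv) (quantile_ne_top h₁ ha hpos hv)
    simp only [eofcIntegrand, nestedInner, deriv_archimedeanLink h₁ ha hpos _ hv]
    rw [logInv_expNeg, logInv_expNeg]
    have hQ := ofReal_toReal_quantile h₁ ha hpos hv
    have hcancel := fun s => ofReal_one_div_mul_ofReal_mul hx s
    simp only [hQ] at hcancel ⊢
    -- The factor `x₀` cancels and `ν⁻¹ ∘ ψ₁₂₃⁻¹ = ψ₁₂⁻¹`, so the first two arguments recombine into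
    -- the inner level of `N`.
    rw [hcancel, hcancel, nuInv_laplaceInv h₁ (hu 0), nuInv_laplaceInv h₁ (hu 1), nu,
      ← expNeg_add, ← mul_add]
  refine ⟨?_, ?_⟩
  · refine (intervalIntegrable_expNeg_quantile_mul (m := m₁) X 0 1).congr_ae ?_
    rw [uIoc_of_le zero_le_one, ← restrict_Ioo_eq_restrict_Ioc]
    filter_upwards [ae_restrict_mem measurableSet_Ioo] with v hv using heq hv
  · rw [← intervalIntegral.integral_congr_Ioo_of_le zero_le_one heq,
      ← laplace_eq_integral_quantile h₁ ha hpos, nestedArchimedean]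

/-! ### Submodularity of `ν` and the copula property -/

section Nested

variable {m₁ m₂ : Measure ℝ} [IsProbabilityMeasure m₁] [IsProbabilityMeasure m₂]

/-- The third variable enters as a factor, so a box volume is a second difference of `exp(-xν)`
times a side length. -/
theorem isCopula_nestedInner (h₁ : m₁ (Iic 0) = 0) (h₂ : m₂ (Iic 0) = 0)
    (hsub : SubmodularSum (nu m₁ m₂)) {x : ℝ} (hx : 0 < x) : IsCopula (nestedInner m₁ m₂ x) where
  grounded := by
    intro u _ ⟨i, hi⟩
    have hx' : ENNReal.ofReal (1 / x) ≠ 0 := by simpa using hx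
    have hx'' : ENNReal.ofReal x ≠ 0 := by simpa using hx
    unfold nestedInner
    fin_cases i
    · simp only [Fin.zero_eta] at hi
      simp [hi, logInv_zero, -one_div, ENNReal.mul_top hx', ENNReal.mul_top hx'', nuInv_top h₁ h₂,
        nu_top h₁ h₂, expNeg_top]
    · simp only [Fin.mk_one] at hi
      simp [hi, logInv_zero, -one_div, ENNReal.mul_top hx', ENNReal.mul_top hx'', nuInv_top h₁ h₂,
        nu_top h₁ h₂, expNeg_top]
    · have hi' : u 2 = 0 := hi
      simp [hi']
  margin := by
    intro i y hy
    unfold nestedInner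
    fin_cases i
    · simp [logInv_one, nuInv_zero h₁ h₂, nu_nuInv h₁ h₂, -one_div,
        ofReal_mul_ofReal_one_div_mul hx, expNeg_logInv hy]
    · simp [logInv_one, nuInv_zero h₁ h₂, nu_nuInv h₁ h₂, -one_div,
        ofReal_mul_ofReal_one_div_mul hx, expNeg_logInv hy]
    · simp [logInv_one, nuInv_zero h₁ h₂, nu_zero h₁ h₂, expNeg_zero]
  increasing := by
    intro a b ha hb hab
    refine (sum_volume_fin_three (fun u v w => expNeg (ENNReal.ofReal x * nu m₁ m₂
      (nuInv m₁ m₂ (ENNReal.ofReal (1 / x) * logInv u) +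
        nuInv m₁ m₂ (ENNReal.ofReal (1 / x) * logInv v))) * w) a b).symm ▸ ?_
    have hA : ∀ i, nuInv m₁ m₂ (ENNReal.ofReal (1 / x) * logInv (b i)) ≤
        nuInv m₁ m₂ (ENNReal.ofReal (1 / x) * logInv (a i)) := fun i =>
      nuInv_monotone h₁ h₂ (mul_le_mul_right (logInv_anti (ha i) (hb i) (hab i)) _)
    have h := hsub.expNeg_nonneg (nu_strictMono h₁ h₂).monotone (fun s => nu_ne_top h₁ h₂)
      (ENNReal.ofReal_ne_top (r := x)) (hA 0) (hA 1)
    have h' := mul_nonneg h (sub_nonneg.2 (hab 2))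
    linarith

/-- `N` mixes over `t` the products of `exp(-tν(a+b))` and `exp(-tψ₁₂₃⁻¹(u₃))`; for each `t` the box
volume is a product of two nonnegative differences. -/
theorem isCopula_nestedArchimedean (h₁ : m₁ (Iic 0) = 0) (h₂ : m₂ (Iic 0) = 0)
    (hsub : SubmodularSum (nu m₁ m₂)) : IsCopula (nestedArchimedean m₁ m₂) where
  grounded := by
    intro u _ ⟨i, hi⟩
    unfold nestedArchimedean
    fin_cases i
    · simp only [Fin.zero_eta] at hi
      simp [hi, laplaceInv_zero h₂, laplaceInv_zero h₁, laplace_top h₁, laplace_top h₂]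
    · simp only [Fin.mk_one] at hi
      simp [hi, laplaceInv_zero h₂, laplaceInv_zero h₁, laplace_top h₁, laplace_top h₂]
    · have hi' : u 2 = 0 := hi
      simp [hi', laplaceInv_zero h₁, laplace_top h₁]
  margin := by
    intro i y hy
    unfold nestedArchimedean
    fin_cases i <;>
    simp [laplaceInv_one h₁, laplaceInv_one h₂, laplace_zero h₂, laplace_laplaceInv h₁ hy,
      laplace_laplaceInv h₂ hy]
  increasing := by
    intro a b ha hb hab
    refine (sum_volume_fin_three (fun u v w => laplace m₁ (nu m₁ m₂
      (laplaceInv m₂ u + laplaceInv m₂ v) + laplaceInv m₁ w)) a b).symm ▸ ?_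
    have hA : ∀ i, laplaceInv m₂ (b i) ≤ laplaceInv m₂ (a i) := fun i =>
      laplaceInv_le_laplaceInv h₂ (ha i) (hb i) (hab i)
    have hB := laplaceInv_le_laplaceInv h₁ (ha 2) (hb 2) (hab 2)
    simp only [laplace_second_difference h₁]
    rw [← integral_sub (integrable_expNeg_second_difference _ _ _ _ _)
      (integrable_expNeg_second_difference _ _ _ _ _)]
    refine integral_nonneg fun t => ?_
    have h := hsub.expNeg_nonneg (nu_strictMono h₁ h₂).monotone (fun s => nu_ne_top h₁ h₂)
      (ENNReal.ofReal_ne_top (r := t)) (hA 0) (hA 1)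
    have h' := mul_nonneg h (sub_nonneg.2 (expNeg_strictAnti.antitone
      (mul_le_mul_right hB (ENNReal.ofReal t))))
    simp only [mul_add, expNeg_add, Pi.zero_apply]
    linarith

theorem submodularSum_nu_of_isCopula (h₁ : m₁ (Iic 0) = 0) (h₂ : m₂ (Iic 0) = 0)
    (hpos : ∀ a b : ℝ, 0 ≤ a → a < b → 0 < m₁ (Ioo a b))
    (hC : IsCopula (nestedArchimedean m₁ m₂)) : SubmodularSum (nu m₁ m₂) := by
  intro a a' b b' haa hbb ha' hb'
  have hfin : ∀ {s t : ℝ≥0∞}, s ≤ a' → t ≤ b' → nu m₁ m₂ (s + t) ≠ ∞ := fun hs ht =>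
    nu_ne_top h₁ h₂ (ENNReal.add_ne_top.2
      ⟨ne_top_of_le_ne_top ha' hs, ne_top_of_le_ne_top hb' ht⟩)
  have hp := hfin haa hbb
  have hz := hfin le_rfl le_rfl
  have hq := hfin le_rfl hbb
  have hr := hfin haa le_rfl
  rw [← ENNReal.toReal_le_toReal (ENNReal.add_ne_top.2 ⟨hp, hz⟩) (ENNReal.add_ne_top.2 ⟨hq, hr⟩),
    ENNReal.toReal_add hp hz, ENNReal.toReal_add hq hr]
  refine add_le_add_of_integral_nonneg h₁ hpos ENNReal.toReal_nonneg ENNReal.toReal_nonneg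
    ENNReal.toReal_nonneg ENNReal.toReal_nonneg fun c hc => ?_
  have hmem : ∀ s, laplace m₂ s ∈ Icc (0 : ℝ) 1 := laplace_mem_Icc h₂
  have hmem₁ : ∀ s, laplace m₁ s ∈ Icc (0 : ℝ) 1 := laplace_mem_Icc h₁
  have hanti := (laplace_strictAnti h₂).antitone
  -- Lower third coordinate `0` removes four of the eight terms, as `ψ₁₂₃⁻¹(0) = ∞`; upper third
  -- coordinate `ψ₁₂₃(c)` supplies the tilt `exp(-tc)`. As `ψ₁₂` decreases, `a'` and `b'` give the
  -- lower corner.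
  have h := hC.increasing ![laplace m₂ a', laplace m₂ b', 0]
    ![laplace m₂ a, laplace m₂ b, laplace m₁ (ENNReal.ofReal c)]
    (by intro i; fin_cases i <;> simp [hmem _ |>.1, hmem _ |>.2])
    (by intro i; fin_cases i <;> simp [hmem _ |>.1, hmem _ |>.2, hmem₁ _ |>.1, hmem₁ _ |>.2])
    (by intro i; fin_cases i <;> simp [hanti haa, hanti hbb, hmem₁ _ |>.1])
  have h := (sum_volume_fin_three (fun u v w => laplace m₁ (nu m₁ m₂
      (laplaceInv m₂ u + laplaceInv m₂ v) + laplaceInv m₁ w)) _ _) ▸ h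
  simp only [Matrix.cons_val, laplaceInv_zero h₁, add_top, laplace_top h₁, sub_zero, add_zero,
    laplaceInv_laplace h₂, laplaceInv_laplace h₁] at h
  rw [laplace_second_difference h₁] at h
  refine h.trans_eq (integral_congr_ae ?_)
  filter_upwards [ae_pos_of_measure_Iic h₁] with t ht
  have hexp : ∀ s : ℝ≥0∞, s ≠ ∞ →
      expNeg (ENNReal.ofReal t * s) = Real.exp (-(t * s.toReal)) := fun s hs => by
    rw [expNeg_of_ne_top (ENNReal.mul_ne_top ENNReal.ofReal_ne_top hs), ENNReal.toReal_mul,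
      ENNReal.toReal_ofReal ht.le]
  have hc' : expNeg (ENNReal.ofReal t * ENNReal.ofReal c) = Real.exp (-(t * c)) := by
    rw [hexp _ ENNReal.ofReal_ne_top, ENNReal.toReal_ofReal hc]
  simp only [mul_add, expNeg_add, hexp _ hp, hexp _ hq, hexp _ hr, hexp _ hz, hc']
  ring

end Nested

theorem mainTheorem3
    (f₀ : ℝ → ℝ) (hf₀_meas : Measurable f₀) (hf₀_nonneg : ∀ t, 0 ≤ f₀ t)
    (hf₀_prob : MeasureTheory.IsProbabilityMeasure (factorLaw f₀))
    (hf₀_supp : (factorLaw f₀).support = Set.Ici 0)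
    (μ₁₂ : MeasureTheory.Measure ℝ) (hμ₁₂_prob : MeasureTheory.IsProbabilityMeasure μ₁₂)
    (hμ₁₂_pos : μ₁₂ (Set.Iic 0) = 0) :
    -- the linking copulas are copulas
    IsBivariateCopula (archimedeanLink (factorLaw f₀)) ∧
    -- the one-factor integral equals the nested Archimedean expression
    HasEOFCRepresentation
      (fun u₀ => nestedInner (factorLaw f₀) μ₁₂ (quantile (factorLaw f₀) u₀).toReal)
      (fun _ => archimedeanLink (factorLaw f₀))
      (nestedArchimedean (factorLaw f₀) μ₁₂) ∧
    -- if the nested Archimedean expression is a copula, every `C_{x₀}` is a copula and the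
    -- nested Archimedean copula is the EOFC with these inner and linking copulas
    (IsCopula (nestedArchimedean (factorLaw f₀) μ₁₂) →
      (∀ x₀ : ℝ, 0 < x₀ → IsCopula (nestedInner (factorLaw f₀) μ₁₂ x₀)) ∧
      IsEOFCOf
        (fun u₀ => nestedInner (factorLaw f₀) μ₁₂ (quantile (factorLaw f₀) u₀).toReal)
        (fun _ => archimedeanLink (factorLaw f₀))
        (nestedArchimedean (factorLaw f₀) μ₁₂)) ∧
    -- and it is a copula as soon as `ν` is concave on `(0,∞)`
    (ConcaveOn ℝ (Set.Ioi (0 : ℝ))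
        (fun s => (nu (factorLaw f₀) μ₁₂ (ENNReal.ofReal s)).toReal) →
      IsCopula (nestedArchimedean (factorLaw f₀) μ₁₂)) := by
  have h₁ := factorLaw_Iic_zero hf₀_supp
  have ha := factorLaw_singleton (f₀ := f₀)
  have hpos : ∀ a b : ℝ, 0 ≤ a → a < b → 0 < factorLaw f₀ (Ioo a b) :=
    fun a b h h' => factorLaw_Ioo_pos hf₀_supp h h'
  have hlink := isBivariateCopula_archimedeanLink h₁ ha hpos
  have hrep := hasEOFCRepresentation_nestedArchimedean (m₂ := μ₁₂) h₁ ha hpos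
  refine ⟨hlink, hrep, fun hC => ?_, fun hconc => ?_⟩
  · have hinner : ∀ x₀ : ℝ, 0 < x₀ → IsCopula (nestedInner (factorLaw f₀) μ₁₂ x₀) := fun x₀ hx₀ =>
      isCopula_nestedInner h₁ hμ₁₂_pos (submodularSum_nu_of_isCopula h₁ hμ₁₂_pos hpos hC) hx₀
    refine ⟨hinner, ⟨fun u₀ hu₀ => hinner _ ?_, fun _ => hlink, hC, hrep⟩⟩
    exact ENNReal.toReal_pos (quantile_pos h₁ ha hpos hu₀) (quantile_ne_top h₁ ha hpos hu₀)
  · exact isCopula_nestedArchimedean h₁ hμ₁₂_pos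
      (submodularSum_of_concaveOn (nu_zero h₁ hμ₁₂_pos) (fun s => nu_ne_top h₁ hμ₁₂_pos) hconc)
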